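/- **Setting.** Let $\mathcal F$ be a $\mathbb Z$-graded supermanifold, given by its algebra of functions $A=\bigoplus A_{(n,\epsilon)}$: a real associative unital algebra graded by ghost number $n\in\mathbb Z$ and parity $\epsilon\in\mathbb Z/2$ and supercommutative, $fg=(-1)^{|f||g|}gf$. (Any such algebra is allowed.) Vector fields are the graded derivations of $A$, with graded commutator $[X,Y]=XY-(-1)^{|X||Y|}YX$; differential forms are the graded-alternating $A$-multilinear functions of vector fields, with de Rham differential $\delta$, contraction $\iota_X$ and Lie derivative $L_X=\iota_X\delta+(-1)^{|X|}\delta\iota_X$ (signs by total parity, i.e. parity plus form degree, so that $L_X\iota_Y-(-1)^{|X|(|Y|+1)}\iota_YL_X=\iota_{[X,Y]}$; in particular $L_Q=\iota_Q\delta-\delta\iota_Q$ for odd $Q$). The form degree is not counted in the ghost number, and an object said to have ghost number $n$ below is understood to have parity $n$ mod $2$. Let $k\in\mathbb Z$ and let $(\mathcal F,\mathcal Q,\omega,\mathcal S)$ be a weak BV manifold of degree $k$: $\mathcal Q$ is a vector field of ghost number $1$, $\omega$ is a closed $2$-form (possibly degenerate) of ghost number $k-1$, $\mathcal S\in A$ is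 a function of ghost number $k$, and $L_{[\mathcal Q,\mathcal Q]}\omega=0$. Neither $\iota_{\mathcal Q}\omega=\delta\mathcal S$ nor $[\mathcal Q,\mathcal Q]=0$ is assumed. Put $$\underline\alpha:=\iota_{\mathcal Q}\omega-\delta\mathcal S,\qquad \underline\omega:=\delta\underline\alpha .$$ Assume that $[\mathcal Q,\mathcal Q]$ is Hamiltonian: let $\mathcal T\in A$ be a function of ghost number $k+1$ with $$\tfrac12\,\iota_{[\mathcal Q,\mathcal Q]}\omega=-\delta\mathcal T .$$ **Proposition.** (a) If $k\neq-1$, there is a unique function $\underline{\mathcal S}$ of ghost number $k+1$ such that $\iota_{\mathcal Q}\underline\omega=\delta\underline{\mathcal S}$. (b) For every $k$ and every function $\underline{\mathcal S}$ of ghost number $k+1$ with $\iota_{\mathcal Q}\underline\omega=\delta\underline{\mathcal S}$, one has $$\tfrac12 L_{\mathcal Q}\underline{\mathcal S}=-L_{\mathcal Q}\mathcal T .$$ Hence, with $\underline{\mathcal T}:=-L_{\mathcal Q}\mathcal T$, the boundary BFV equivariant CME $\tfrac12L_{\mathcal Q}\underline{\mathcal S}=\underline{\mathcal T}$ holds,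 and moreover $$\tfrac12\,\iota_{[\mathcal Q,\mathcal Q]}\underline\omega=-\delta\underline{\mathcal T}.$$ -/

import Mathlib

/-!
Graded manifolds (of finite or infinite dimension) are handled through their algebra of functions:
a supercommutative real algebra `A` that is the direct sum of its homogeneous parts for the ghost
number (in `ℤ`) and the parity (in `ℤ/2`); the two gradings are kept independent, and a manifold
whose parity is the ghost number mod 2 is the case `𝒜 (n, ε) = 0` for `ε ≠ n mod 2`.
No further property of `A` is assumed, so that every graded manifold is covered.
Vector fields are the graded derivations of `A`, and differential forms are the graded alternating `A`-multilinear
functions of vector fields.  Signs follow the total parity (internal parity plus form degree), so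
that `ι_X` has parity `|X| + 1`, `δ` is odd, and
`L_X = ι_X δ + (-1)^{|X|} δ ι_X`, `L_X ι_Y - (-1)^{|X|(|Y|+1)} ι_Y L_X = ι_{[X,Y]}`.
For an odd vector field `Q` these read `L_Q = ι_Q δ - δ ι_Q`, `L_Q ι_Q - ι_Q L_Q = ι_{[Q,Q]}`.
-/

namespace GrMfd

/-- Degrees: ghost number and parity. -/
abbrev Deg : Type := ℤ × ZMod 2

/-- The degree with ghost number `n` and parity `n mod 2`. -/
def gh (n : ℤ) : Deg := (n, (n : ZMod 2))

/-- The sign `(-1)^a`. -/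
def sgn (a : ZMod 2) : ℝ := if a = 0 then 1 else -1

theorem sgn_add (a b : ZMod 2) : sgn (a + b) = sgn a * sgn b := by
  have h : ∀ a b : ZMod 2, (if a + b = 0 then (1 : ℤ) else -1) =
      (if a = 0 then 1 else -1) * (if b = 0 then 1 else -1) := by decide
  have := congrArg (fun z : ℤ => (z : ℝ)) (h a b)
  simpa [sgn] using this

theorem sgn_one : sgn 1 = -1 := by simp [sgn]

theorem sgn_eq (a : ZMod 2) : sgn a = 1 ∨ sgn a = -1 := by
  unfold sgn; split_ifs <;> simp

variable {A : Type*} [Ring A] [Algebra ℝ A]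

/-- Graded commutativity of a `ℤ × ℤ/2`-graded algebra: `f g = (-1)^{|f||g|} g f`. -/
class SuperCommutative (𝒜 : Deg → Submodule ℝ A) : Prop where
  comm : ∀ {c d : Deg} {f g : A}, f ∈ 𝒜 c → g ∈ 𝒜 d → f * g = sgn (c.2 * d.2) • (g * f)

variable (𝒜 : Deg → Submodule ℝ A)

/-- Vector fields of degree `d`: the graded derivations of `A` of degree `d`. -/
def VF (d : Deg) : Submodule ℝ (A →ₗ[ℝ] A) where
  carrier := {X | (∀ (c : Deg) (f : A), f ∈ 𝒜 c → X f ∈ 𝒜 (d + c)) ∧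
    ∀ (c : Deg) (f : A), f ∈ 𝒜 c → ∀ g : A,
      X (f * g) = X f * g + sgn (d.2 * c.2) • (f * X g)}
  zero_mem' := ⟨fun c f _ => by simp, fun c f _ g => by simp⟩
  add_mem' := by
    rintro X Y ⟨hX, hX'⟩ ⟨hY, hY'⟩
    refine ⟨fun c f hf => add_mem (hX c f hf) (hY c f hf), fun c f hf g => ?_⟩
    simp only [LinearMap.add_apply, hX' c f hf g, hY' c f hf g, add_mul, mul_add, smul_add]
    abel
  smul_mem' := by
    rintro r X ⟨hX, hX'⟩
    refine ⟨fun c f hf => Submodule.smul_mem _ r (hX c f hf), fun c f hf g => ?_⟩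
    simp only [LinearMap.smul_apply, hX' c f hf g, smul_add, smul_mul_assoc, mul_smul_comm]
    rw [smul_comm r]

variable {𝒜}

theorem vf_mem {d c : Deg} (X : VF 𝒜 d) {f : A} (hf : f ∈ 𝒜 c) : X.1 f ∈ 𝒜 (d + c) :=
  X.2.1 c f hf

theorem vf_mul {d c : Deg} (X : VF 𝒜 d) {f : A} (hf : f ∈ 𝒜 c) (g : A) :
    X.1 (f * g) = X.1 f * g + sgn (d.2 * c.2) • (f * X.1 g) :=
  X.2.2 c f hf g

/-- The vector field `f X`, that is `g ↦ f * X g`. -/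
def fsmul [GradedAlgebra 𝒜] [SuperCommutative 𝒜] {c d : Deg} (f : A) (hf : f ∈ 𝒜 c)
    (X : VF 𝒜 d) : VF 𝒜 (c + d) :=
  ⟨LinearMap.mulLeft ℝ f ∘ₗ X.1, by
    refine ⟨fun b g hg => ?_, fun b g hg h => ?_⟩
    · rw [add_assoc]
      exact SetLike.mul_mem_graded hf (vf_mem X hg)
    · simp only [LinearMap.comp_apply, LinearMap.mulLeft_apply, vf_mul X hg h, mul_add,
        mul_smul_comm, Prod.snd_add, add_mul, sgn_add, mul_assoc]
      rw [← mul_assoc f g, SuperCommutative.comm hf hg, smul_mul_assoc, smul_smul, mul_assoc,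
        mul_comm (sgn (d.2 * b.2))]⟩

/-- The graded commutator `[X, Y] = X Y - (-1)^{|X||Y|} Y X` of vector fields. -/
def bracket {d e : Deg} (X : VF 𝒜 d) (Y : VF 𝒜 e) : VF 𝒜 (d + e) :=
  ⟨X.1 ∘ₗ Y.1 - sgn (d.2 * e.2) • (Y.1 ∘ₗ X.1), by
    refine ⟨fun c f hf => ?_, fun c f hf g => ?_⟩
    · refine sub_mem ?_ (Submodule.smul_mem _ _ ?_)
      · rw [add_assoc]
        exact vf_mem X (vf_mem Y hf)
      · rw [add_comm d e, add_assoc]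
        exact vf_mem Y (vf_mem X hf)
    · simp only [LinearMap.sub_apply, LinearMap.smul_apply, LinearMap.comp_apply,
        vf_mul X hf g, vf_mul Y hf g, map_add, map_smul, vf_mul X (vf_mem Y hf) g,
        vf_mul Y (vf_mem X hf) g, vf_mul X hf (Y.1 g), vf_mul Y hf (X.1 g), Prod.snd_add,
        add_mul, mul_add, sgn_add, sub_mul, mul_sub, smul_mul_assoc,
        mul_smul_comm, mul_comm e.2 d.2]
      rcases sgn_eq (d.2 * e.2) with h1 | h1 <;> rcases sgn_eq (d.2 * c.2) with h2 | h2 <;>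
        rcases sgn_eq (e.2 * c.2) with h3 | h3 <;> simp only [h1, h2, h3] <;> module⟩

theorem fsmul_val [GradedAlgebra 𝒜] [SuperCommutative 𝒜] {c d : Deg} (f : A)
    (hf : f ∈ 𝒜 c) (X : VF 𝒜 d) (g : A) : (fsmul f hf X).1 g = f * X.1 g := rfl

theorem bracket_val {d e : Deg} (X : VF 𝒜 d) (Y : VF 𝒜 e) (f : A) :
    (bracket X Y).1 f = X.1 (Y.1 f) - sgn (d.2 * e.2) • Y.1 (X.1 f) := rfl

theorem bracket_add_left {d e : Deg} (X X' : VF 𝒜 d) (Y : VF 𝒜 e) :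
    bracket (X + X') Y = bracket X Y + bracket X' Y := by
  ext f
  simp only [bracket_val, Submodule.coe_add, LinearMap.add_apply, map_add, smul_add]
  abel

theorem bracket_add_right {d e : Deg} (X : VF 𝒜 d) (Y Y' : VF 𝒜 e) :
    bracket X (Y + Y') = bracket X Y + bracket X Y' := by
  ext f
  simp only [bracket_val, Submodule.coe_add, LinearMap.add_apply, map_add, smul_add]
  abel

theorem bracket_smul_left {d e : Deg} (r : ℝ) (X : VF 𝒜 d) (Y : VF 𝒜 e) :
    bracket (r • X) Y = r • bracket X Y := by
  ext f
  simp only [bracket_val, Submodule.coe_smul, LinearMap.smul_apply, map_smul, smul_sub]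
  rw [smul_comm r]

theorem bracket_smul_right {d e : Deg} (r : ℝ) (X : VF 𝒜 d) (Y : VF 𝒜 e) :
    bracket X (r • Y) = r • bracket X Y := by
  ext f
  simp only [bracket_val, Submodule.coe_smul, LinearMap.smul_apply, map_smul, smul_sub]
  rw [smul_comm r]

variable (𝒜) [GradedAlgebra 𝒜] [SuperCommutative 𝒜]

/-- Differential 1-forms, with `η d X = ι_X η` for `X` of degree `d`; thus `ι_{fX} η = f ι_X η`. -/
def Form1 : Submodule ℝ (∀ d : Deg, VF 𝒜 d →ₗ[ℝ] A) where
  carrier := {η | ∀ (c d : Deg) (f : A) (hf : f ∈ 𝒜 c) (X : VF 𝒜 d),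
    η (c + d) (fsmul f hf X) = f * η d X}
  zero_mem' := fun c d f hf X => by simp
  add_mem' := fun {η η'} h h' c d f hf X => by
    simp only [Pi.add_apply, LinearMap.add_apply, h c d f hf X, h' c d f hf X, mul_add]
  smul_mem' := fun r η h c d f hf X => by
    simp only [Pi.smul_apply, LinearMap.smul_apply, h c d f hf X, mul_smul_comm]

/-- Differential 2-forms, with `ω d e X Y = ι_X ι_Y ω` for `X`, `Y` of degrees `d`, `e`: linear
over functions in `X` and graded symmetric for the shifted parities `|X| + 1`, `|Y| + 1`, that is
`ι_X ι_Y = (-1)^{(|X|+1)(|Y|+1)} ι_Y ι_X` (alternating on even vector fields). -/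
def Form2 : Submodule ℝ (∀ d e : Deg, VF 𝒜 d →ₗ[ℝ] VF 𝒜 e →ₗ[ℝ] A) where
  carrier := {ω |
    (∀ (c d e : Deg) (f : A) (hf : f ∈ 𝒜 c) (X : VF 𝒜 d) (Y : VF 𝒜 e),
      ω (c + d) e (fsmul f hf X) Y = f * ω d e X Y) ∧
    ∀ (d e : Deg) (X : VF 𝒜 d) (Y : VF 𝒜 e),
      ω d e X Y = sgn ((d.2 + 1) * (e.2 + 1)) • ω e d Y X}
  zero_mem' := ⟨fun c d e f hf X Y => by simp, fun d e X Y => by simp⟩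
  add_mem' := by
    rintro ω ω' ⟨h1, h2⟩ ⟨h1', h2'⟩
    refine ⟨fun c d e f hf X Y => ?_, fun d e X Y => ?_⟩
    · simp only [Pi.add_apply, LinearMap.add_apply, h1 c d e f hf X Y, h1' c d e f hf X Y,
        mul_add]
    · simp only [Pi.add_apply, LinearMap.add_apply, smul_add]
      rw [h2 d e X Y, h2' d e X Y]
  smul_mem' := by
    rintro r ω ⟨h1, h2⟩
    refine ⟨fun c d e f hf X Y => ?_, fun d e X Y => ?_⟩
    · simp only [Pi.smul_apply, LinearMap.smul_apply, h1 c d e f hf X Y, mul_smul_comm]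
    · simp only [Pi.smul_apply, LinearMap.smul_apply]
      rw [h2 d e X Y, smul_comm r]

variable {𝒜}

/-- Contraction `ι_X η` of a 1-form. -/
def contr1 {d : Deg} (X : VF 𝒜 d) (η : Form1 𝒜) : A := η.1 d X

/-- Contraction `ι_Y ω` of a 2-form. -/
def contr2 {e : Deg} (Y : VF 𝒜 e) (ω : Form2 𝒜) : Form1 𝒜 :=
  ⟨fun d => (ω.1 d e).flip Y, fun c d f hf X => ω.2.1 c d e f hf X Y⟩

/-- The de Rham differential of a function: `ι_X δf = X f`. -/
def d0 (f : A) : Form1 𝒜 :=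
  ⟨fun _ => (LinearMap.applyₗ f) ∘ₗ Submodule.subtype _, fun _ _ _ _ _ => rfl⟩

/-- The Lie derivative of a function, `L_X f = ι_X δf`. -/
def lie0 {d : Deg} (X : VF 𝒜 d) (f : A) : A := contr1 X (d0 f)

/-- `ι_X (L_Z η)` for a 1-form `η`, where
`ι_X L_Z = (-1)^{|Z|(|X|+1)} (L_Z ι_X - ι_{[Z,X]})`. -/
def lie1 {z d : Deg} (Z : VF 𝒜 z) (η : Form1 𝒜) (X : VF 𝒜 d) : A :=
  sgn (z.2 * (d.2 + 1)) • (lie0 Z (contr1 X η) - contr1 (bracket Z X) η)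

/-- `ι_X ι_Y (L_Z ω)` for a 2-form `ω`, by the same rule applied to `ι_Y`. -/
def lie2 {z d e : Deg} (Z : VF 𝒜 z) (ω : Form2 𝒜) (X : VF 𝒜 d) (Y : VF 𝒜 e) : A :=
  sgn (z.2 * (e.2 + 1)) • (lie1 Z (contr2 Y ω) X - contr1 X (contr2 (bracket Z Y) ω))

/-- `ι_X ι_Y (δη)` for a 1-form `η`, from `ι_Y δη = L_Y η - (-1)^{|Y|} δ ι_Y η`.  For even `X`,
`Y` this is `Y(η(X)) - X(η(Y)) - η([Y, X])`. -/
def d1val (η : Form1 𝒜) {d e : Deg} (X : VF 𝒜 d) (Y : VF 𝒜 e) : A :=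
  lie1 Y η X - sgn e.2 • lie0 X (contr1 Y η)

/-- `ι_X ι_Y ι_Z (δω)` for a 2-form `ω`, from `ι_Z δω = L_Z ω - (-1)^{|Z|} δ ι_Z ω`. -/
def d2val (ω : Form2 𝒜) {d e z : Deg} (X : VF 𝒜 d) (Y : VF 𝒜 e) (Z : VF 𝒜 z) : A :=
  lie2 Z ω X Y - sgn z.2 • d1val (contr2 Z ω) X Y

theorem lie0_val {d : Deg} (X : VF 𝒜 d) (f : A) : lie0 X f = X.1 f := rfl

theorem contr1_congr (η : Form1 𝒜) {d e : Deg} (h : d = e) (X : VF 𝒜 d) (Y : VF 𝒜 e)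
    (hXY : ∀ f, X.1 f = Y.1 f) : contr1 X η = contr1 Y η := by
  subst h
  rw [show X = Y from Subtype.ext (LinearMap.ext hXY)]

theorem contr1_add {d : Deg} (X Y : VF 𝒜 d) (η : Form1 𝒜) :
    contr1 (X + Y) η = contr1 X η + contr1 Y η := map_add (η.1 d) X Y

theorem contr1_sub {d : Deg} (X Y : VF 𝒜 d) (η : Form1 𝒜) :
    contr1 (X - Y) η = contr1 X η - contr1 Y η := map_sub (η.1 d) X Y

theorem contr1_smul {d : Deg} (r : ℝ) (X : VF 𝒜 d) (η : Form1 𝒜) :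
    contr1 (r • X) η = r • contr1 X η := map_smul (η.1 d) r X

theorem contr1_fsmul {c d : Deg} (f : A) (hf : f ∈ 𝒜 c) (X : VF 𝒜 d) (η : Form1 𝒜) :
    contr1 (fsmul f hf X) η = f * contr1 X η := η.2 c d f hf X

theorem d1val_fsmul (η : Form1 𝒜) {c d e : Deg} (f : A) (hf : f ∈ 𝒜 c) (X : VF 𝒜 d)
    (Y : VF 𝒜 e) : d1val η (fsmul f hf X) Y = f * d1val η X Y := by
  have hb : contr1 (bracket Y (fsmul f hf X)) η =
      Y.1 f * contr1 X η + sgn (e.2 * c.2) • (f * contr1 (bracket Y X) η) := by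
    have h1 := contr1_fsmul (Y.1 f) (vf_mem Y hf) X η
    have h2 := contr1_fsmul f hf (bracket Y X) η
    have h3 : contr1 (fsmul (Y.1 f) (vf_mem Y hf) X) η =
        contr1 (bracket Y (fsmul f hf X) - sgn (e.2 * c.2) •
          (⟨(fsmul f hf (bracket Y X)).1, by
            rw [← add_assoc, add_comm e c, add_assoc]
            exact (fsmul f hf (bracket Y X)).2⟩ : VF 𝒜 (e + (c + d)))) η := by
      refine contr1_congr η (add_assoc e c d) _ _ fun g => ?_
      change Y.1 f * X.1 g = Y.1 (f * X.1 g) - sgn (e.2 * (c + d).2) • (f * X.1 (Y.1 g)) -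
        sgn (e.2 * c.2) • (f * (Y.1 (X.1 g) - sgn (e.2 * d.2) • X.1 (Y.1 g)))
      rw [vf_mul Y hf, Prod.snd_add, mul_add, sgn_add, mul_sub, mul_smul_comm]
      module
    have h4 : contr1 (⟨(fsmul f hf (bracket Y X)).1, by
            rw [← add_assoc, add_comm e c, add_assoc]
            exact (fsmul f hf (bracket Y X)).2⟩ : VF 𝒜 (e + (c + d))) η =
        contr1 (fsmul f hf (bracket Y X)) η :=
      contr1_congr η (by abel) _ _ fun g => rfl
    rw [contr1_sub, contr1_smul, h4, h1, h2] at h3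
    rw [h3]
    module
  simp only [d1val, lie1, hb, contr1_fsmul, lie0_val, fsmul_val, Prod.snd_add]
  rw [vf_mul Y hf, add_assoc, mul_add e.2 c.2, sgn_add]
  simp only [mul_sub, mul_smul_comm]
  rcases sgn_eq (e.2 * c.2) with h1 | h1 <;> simp only [h1] <;> module

theorem d1val_symm (η : Form1 𝒜) {d e : Deg} (X : VF 𝒜 d) (Y : VF 𝒜 e) :
    d1val η X Y = sgn ((d.2 + 1) * (e.2 + 1)) • d1val η Y X := by
  have hb : contr1 (bracket X Y) η = -sgn (d.2 * e.2) • contr1 (bracket Y X) η := by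
    rw [← contr1_smul]
    refine contr1_congr η (add_comm d e) _ _ fun f => ?_
    change _ = -sgn (d.2 * e.2) • (bracket Y X).1 f
    rw [bracket_val, bracket_val, mul_comm e.2 d.2]
    rcases sgn_eq (d.2 * e.2) with h1 | h1 <;> simp only [h1] <;> module
  simp only [d1val, lie1, hb, mul_add, add_mul, mul_one, one_mul, sgn_add, sgn_one,
    mul_comm e.2 d.2]
  rcases sgn_eq (d.2 * e.2) with h1 | h1 <;> rcases sgn_eq d.2 with h2 | h2 <;>
    rcases sgn_eq e.2 with h3 | h3 <;> simp only [h1, h2, h3] <;> module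

/-- The de Rham differential `δη` of a 1-form. -/
def d1 (η : Form1 𝒜) : Form2 𝒜 :=
  ⟨fun d e => LinearMap.mk₂ ℝ (fun X Y => d1val η X Y)
    (fun X X' Y => by
      simp only [d1val, lie1, lie0_val, bracket_add_right, contr1_add, map_add,
        Submodule.coe_add, LinearMap.add_apply]
      module)
    (fun r X Y => by
      simp only [d1val, lie1, lie0_val, bracket_smul_right, contr1_smul, map_smul,
        Submodule.coe_smul, LinearMap.smul_apply]
      module)
    (fun X Y Y' => by
      simp only [d1val, lie1, lie0_val, bracket_add_left, contr1_add, map_add,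
        Submodule.coe_add, LinearMap.add_apply]
      module)
    (fun r X Y => by
      simp only [d1val, lie1, lie0_val, bracket_smul_left, contr1_smul, map_smul,
        Submodule.coe_smul, LinearMap.smul_apply]
      module),
    fun _ _ _ f hf X Y => d1val_fsmul η f hf X Y, fun _ _ X Y => d1val_symm η X Y⟩

/-- The 2-form `ω` is homogeneous of degree `m` (form degree not counted). -/
def HasDegree (ω : Form2 𝒜) (m : Deg) : Prop :=
  ∀ (d e : Deg) (X : VF 𝒜 d) (Y : VF 𝒜 e), contr1 X (contr2 Y ω) ∈ 𝒜 (d + e + m)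

/-- `δω = 0`. -/
def IsClosedForm (ω : Form2 𝒜) : Prop :=
  ∀ (d e z : Deg) (X : VF 𝒜 d) (Y : VF 𝒜 e) (Z : VF 𝒜 z), d2val ω X Y Z = 0

variable (𝒜)

/-- A weak BV manifold of degree `k` (with function algebra `A` graded by `𝒜`). -/
structure WeakBV (k : ℤ) where
  Q : VF 𝒜 (gh 1)
  ω : Form2 𝒜
  S : A
  ω_degree : HasDegree ω (gh (k - 1))
  ω_closed : IsClosedForm ω
  S_degree : S ∈ 𝒜 (gh k)
  lie_QQ : ∀ (d e : Deg) (X : VF 𝒜 d) (Y : VF 𝒜 e), lie2 (bracket Q Q) ω X Y = 0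

namespace WeakBV

variable {𝒜} {k : ℤ} (M : WeakBV 𝒜 k)

/-- `[Q, Q]` -/
def QQ : VF 𝒜 (gh 1 + gh 1) := bracket M.Q M.Q

/-- The 1-form `α̲ = ι_Q ω - δS`. -/
def bdryα : Form1 𝒜 := contr2 M.Q M.ω - d0 M.S

/-- The 2-form `ω̲ = δα̲`. -/
def bdryω : Form2 𝒜 := d1 M.bdryα

/-- `T`, of ghost number `k + 1`, is such that `½ ι_{[Q,Q]} ω = -δT`: the vector field `[Q, Q]`
is Hamiltonian, with `T` measuring the violation of the classical master equation. -/
def IsViolation (T : A) : Prop :=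
  T ∈ 𝒜 (gh (k + 1)) ∧ (1 / 2 : ℝ) • contr2 M.QQ M.ω = -d0 T

/-- `S̲`, of ghost number `k + 1`, is such that `ι_Q ω̲ = δS̲`. -/
def IsBdryAction (S' : A) : Prop :=
  S' ∈ 𝒜 (gh (k + 1)) ∧ contr2 M.Q M.bdryω = d0 S'

/-- `T̲ = -L_Q T`. -/
def bdryT (T : A) : A := -lie0 M.Q T

end WeakBV

end GrMfd

namespace GrMfd

/-! Everything is Cartan calculus, with the sign identities checked by splitting on parities.

Existence rests on the Euler field `E`, which multiplies a function by its ghost number. If a 1-form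
`η` of ghost number `m` is closed, then `m η = L_E η = δ ι_E η`, so `η` is exact as soon as `m ≠ 0`
(`smul_contr1_of_closed`). Here `η = ι_Q ω̲` and `m = k + 1`, hence the exception `k = -1`.
Closedness of `η`: since `δω = 0` and `δ² = 0`, `ω̲ = δ ι_Q ω = -L_Q ω`, so `δ ι_Q ω̲ = -L_Q ω̲ =
L_Q L_Q ω = ½ L_{[Q,Q]} ω = 0` (`lie2_d1_contr2`, `d1val_contr2_bdryω`).

For (b), `L_Q S̲ = ι_Q ι_Q ω̲`, and `δω = 0` evaluated on `(Q, Q, Q)` turns this into `ι_Q ι_{[Q,Q]}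
ω = -2 L_Q T` (`contr1_contr2_bdryω_Q`). The Hamiltonian property of `[Q,Q]` for `ω̲` follows by
commuting `ι_{[Q,Q]}` with `L_Q`, as `[Q,[Q,Q]] = 0`. -/

theorem sgn_zero : sgn 0 = 1 := by simp [sgn]

theorem zmod2_cases (a : ZMod 2) : a = 0 ∨ a = 1 := by
  revert a; decide

section

variable {A : Type*} [Ring A] [Algebra ℝ A] {𝒜 : Deg → Submodule ℝ A}

/-! ### The Euler vector field of the ghost number -/

section Euler

variable [GradedAlgebra 𝒜]

variable (𝒜) in
/-- The linear map multiplying a function of ghost number `n` by `n`. -/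
noncomputable def eulerMap : A →ₗ[ℝ] A :=
  (DirectSum.toModule ℝ Deg A fun c => (c.1 : ℝ) • (𝒜 c).subtype) ∘ₗ
    (DirectSum.decomposeLinearEquiv 𝒜).toLinearMap

theorem eulerMap_apply {c : Deg} {f : A} (hf : f ∈ 𝒜 c) : eulerMap 𝒜 f = (c.1 : ℝ) • f := by
  lift f to 𝒜 c using hf
  simp only [eulerMap, LinearMap.comp_apply, LinearEquiv.coe_coe,
    DirectSum.decomposeLinearEquiv_apply, DirectSum.decompose_coe]
  exact DirectSum.toModule_lof (M := fun c => 𝒜 c) ℝ c f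

variable (𝒜) in
/-- The Euler vector field of the ghost number. -/
noncomputable def euler : VF 𝒜 0 :=
  ⟨eulerMap 𝒜, by
    refine ⟨fun c f hf => ?_, fun c f hf g => ?_⟩
    · rw [eulerMap_apply hf, zero_add]
      exact Submodule.smul_mem _ _ hf
    · have h0 : sgn ((0 : Deg).2 * c.2) = 1 := by simp [sgn]
      rw [h0, one_smul]
      induction g using DirectSum.Decomposition.inductionOn 𝒜 with
      | zero => simp
      | @homogeneous d g =>
        rw [eulerMap_apply hf, eulerMap_apply g.2,
          eulerMap_apply (SetLike.mul_mem_graded hf g.2), Prod.fst_add, Int.cast_add,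
          smul_mul_assoc, mul_smul_comm, add_smul]
      | add g g' h h' =>
        rw [mul_add, map_add, h, h', map_add, mul_add, mul_add]
        abel⟩

theorem euler_val {c : Deg} {f : A} (hf : f ∈ 𝒜 c) : (euler 𝒜).1 f = (c.1 : ℝ) • f :=
  eulerMap_apply hf

/-- The bracket with the Euler vector field multiplies a vector field by its ghost number. -/
theorem bracket_euler_val {d : Deg} (X : VF 𝒜 d) (f : A) :
    (bracket (euler 𝒜) X).1 f = (d.1 : ℝ) • X.1 f := by
  have h0 : sgn ((0 : Deg).2 * d.2) = 1 := by simp [sgn]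
  rw [bracket_val, h0, one_smul]
  induction f using DirectSum.Decomposition.inductionOn 𝒜 with
  | zero => simp
  | @homogeneous c f =>
    rw [euler_val (vf_mem X f.2), euler_val f.2, map_smul, Prod.fst_add, Int.cast_add]
    module
  | add f g h h' =>
    simp only [map_add, smul_add, ← h, ← h']
    abel

end Euler

/-! ### Cartan calculus on 1-forms and 2-forms -/

variable [GradedAlgebra 𝒜] [SuperCommutative 𝒜]

theorem form1_ext {η η' : Form1 𝒜} (h : ∀ (d : Deg) (X : VF 𝒜 d), contr1 X η = contr1 X η') :
    η = η' :=
  Subtype.ext (funext fun d => LinearMap.ext fun X => h d X)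

theorem contr1_d0 {d : Deg} (X : VF 𝒜 d) (f : A) : contr1 X (d0 f) = X.1 f := rfl

theorem contr1_form_sub {d : Deg} (X : VF 𝒜 d) (η η' : Form1 𝒜) :
    contr1 X (η - η') = contr1 X η - contr1 X η' := rfl

theorem contr1_form_neg {d : Deg} (X : VF 𝒜 d) (η : Form1 𝒜) :
    contr1 X (-η) = -contr1 X η := rfl

theorem contr1_form_smul {d : Deg} (r : ℝ) (X : VF 𝒜 d) (η : Form1 𝒜) :
    contr1 X (r • η) = r • contr1 X η := rfl

theorem contr2_d1 {d e : Deg} (X : VF 𝒜 d) (Y : VF 𝒜 e) (η : Form1 𝒜) :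
    contr1 X (contr2 Y (d1 η)) = d1val η X Y := rfl

theorem contr2_symm {d e : Deg} (X : VF 𝒜 d) (Y : VF 𝒜 e) (ω : Form2 𝒜) :
    contr1 X (contr2 Y ω) = sgn ((d.2 + 1) * (e.2 + 1)) • contr1 Y (contr2 X ω) :=
  ω.2.2 d e X Y

theorem contr2_smul {e : Deg} (r : ℝ) (Y : VF 𝒜 e) (ω : Form2 𝒜) :
    contr2 (r • Y) ω = r • contr2 Y ω :=
  form1_ext fun d X => map_smul (ω.1 d e X) r Y

theorem contr2_zero {e : Deg} (ω : Form2 𝒜) : contr2 (0 : VF 𝒜 e) ω = 0 :=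
  form1_ext fun d X => map_zero (ω.1 d e X)

theorem contr2_congr (ω : Form2 𝒜) {d e : Deg} (h : d = e) (X : VF 𝒜 d) (Y : VF 𝒜 e)
    (hXY : ∀ f, X.1 f = Y.1 f) : contr2 X ω = contr2 Y ω := by
  subst h
  rw [show X = Y from Subtype.ext (LinearMap.ext hXY)]

theorem d1val_sub (η η' : Form1 𝒜) {d e : Deg} (X : VF 𝒜 d) (Y : VF 𝒜 e) :
    d1val (η - η') X Y = d1val η X Y - d1val η' X Y := by
  simp only [d1val, lie1, lie0_val, contr1_form_sub, map_sub]
  module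

theorem d1val_d0 (f : A) {d e : Deg} (X : VF 𝒜 d) (Y : VF 𝒜 e) : d1val (d0 f) X Y = 0 := by
  simp only [d1val, lie1, lie0_val, contr1_d0, bracket_val]
  rcases zmod2_cases d.2 with hd | hd <;> rcases zmod2_cases e.2 with he | he <;>
    simp [hd, he, sgn_zero, sgn_one, CharTwo.add_self_eq_zero]

/-- The graded Jacobi identity, evaluated on a 1-form. -/
theorem contr1_jacobi (η : Form1 𝒜) {d e z : Deg} (X : VF 𝒜 d) (Y : VF 𝒜 e) (Z : VF 𝒜 z) :
    contr1 (bracket (bracket Z Y) X) η = contr1 (bracket Z (bracket Y X)) η -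
      sgn (z.2 * e.2) • contr1 (bracket Y (bracket Z X)) η := by
  -- The double brackets have equal but not definitionally equal degrees, so one of them is
  -- repackaged in degree `z + e + d` before adding.
  have h : contr1 (bracket Z (bracket Y X)) η = contr1 (bracket (bracket Z Y) X +
      sgn (z.2 * e.2) • (⟨(bracket Y (bracket Z X)).1, by
        rw [add_comm z e, add_assoc]
        exact (bracket Y (bracket Z X)).2⟩ : VF 𝒜 (z + e + d))) η := by
    refine contr1_congr η (add_assoc z e d).symm _ _ fun f => ?_
    rw [Submodule.coe_add, LinearMap.add_apply, Submodule.coe_smul, LinearMap.smul_apply]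
    simp only [bracket_val, Prod.snd_add, map_sub, map_smul]
    rcases zmod2_cases d.2 with hd | hd <;> rcases zmod2_cases e.2 with he | he <;>
      rcases zmod2_cases z.2 with hz | hz <;>
      simp only [hd, he, hz, sgn_zero, sgn_one, CharTwo.add_self_eq_zero, mul_zero,
        mul_one, add_zero, zero_add] <;> module
  have h' : contr1 (⟨(bracket Y (bracket Z X)).1, by
        rw [add_comm z e, add_assoc]
        exact (bracket Y (bracket Z X)).2⟩ : VF 𝒜 (z + e + d)) η =
      contr1 (bracket Y (bracket Z X)) η :=
    contr1_congr η (by abel) _ _ fun f => rfl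
  rw [h, contr1_add, contr1_smul, h']
  abel

/-- `δ² = 0` on 1-forms. -/
theorem isClosedForm_d1 (η : Form1 𝒜) : IsClosedForm (d1 η) := by
  intro d e z X Y Z
  -- Jacobi cancels the contractions with double brackets; the remaining terms cancel by the
  -- definition of the bracket on functions.
  have hj := contr1_jacobi η X Y Z
  simp only [d2val, lie2, lie1, lie0_val, contr2_d1, d1val, hj, bracket_val, Prod.snd_add,
    map_sub, map_smul]
  rcases zmod2_cases d.2 with hd | hd <;> rcases zmod2_cases e.2 with he | he <;>
    rcases zmod2_cases z.2 with hz | hz <;>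
    simp only [hd, he, hz, sgn_zero, sgn_one, CharTwo.add_self_eq_zero, mul_zero,
      mul_one, add_zero, zero_add] <;> module

/-- `L_Q δ ι_Q ω = -½ L_{[Q, Q]} ω` for a closed 2-form `ω` and an odd vector field `Q`. -/
theorem lie2_d1_contr2 {ω : Form2 𝒜} (hω : IsClosedForm ω) {q : Deg} (hq : q.2 = 1)
    (Q : VF 𝒜 q) {d e : Deg} (X : VF 𝒜 d) (Y : VF 𝒜 e) :
    lie2 Q (d1 (contr2 Q ω)) X Y = -(1 / 2 : ℝ) • lie2 (bracket Q Q) ω X Y := by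
  have h : ∀ {d e : Deg} (X : VF 𝒜 d) (Y : VF 𝒜 e),
      d1val (contr2 Q ω) X Y = -lie2 Q ω X Y := fun X Y => by
    have := hω _ _ _ X Y Q
    rw [d2val, hq, sgn_one] at this
    linear_combination (norm := module) this
  -- For odd `Q`, Jacobi gives `[Q,[Q,X]] = ½ [[Q,Q],X]`; this is the source of the factor `½`.
  have hX : ∀ {d : Deg} (X : VF 𝒜 d) (η : Form1 𝒜), contr1 (bracket Q (bracket Q X)) η =
      (1 / 2 : ℝ) • contr1 (bracket (bracket Q Q) X) η := fun X η => by
    rw [contr1_jacobi, hq, mul_one, sgn_one]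
    module
  -- Graded symmetry moves the double bracket to the outer slot, where `hX` applies, and back; both
  -- double brackets have the same parity, so the signs agree.
  have hY : contr1 X (contr2 (bracket Q (bracket Q Y)) ω) =
      (1 / 2 : ℝ) • contr1 X (contr2 (bracket (bracket Q Q) Y) ω) := by
    rw [contr2_symm, hX, contr2_symm X (bracket (bracket Q Q) Y), smul_comm]
    simp only [Prod.snd_add, add_assoc]
  simp only [lie2, contr2_d1, lie1, lie0_val, h, hX, hY, bracket_val, Prod.snd_add, map_sub,
    map_smul, map_neg, hq]
  rcases zmod2_cases d.2 with hd | hd <;> rcases zmod2_cases e.2 with he | he <;>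
    simp only [hd, he, sgn_zero, sgn_one, CharTwo.add_self_eq_zero, mul_zero,
      mul_one, add_zero, zero_add] <;> module

/-- A closed 1-form `η` of ghost number `m` satisfies `m η = δ ι_E η` for the Euler field `E`. -/
theorem smul_contr1_of_closed {η : Form1 𝒜} {m d : Deg} (X : VF 𝒜 d)
    (hη : contr1 X η ∈ 𝒜 (d + m)) (hc : d1val η X (euler 𝒜) = 0) :
    (m.1 : ℝ) • contr1 X η = X.1 (contr1 (euler 𝒜) η) := by
  -- In `L_E η`, the weight `d + m` of `ι_X η` loses the weight `d` of `X`, leaving `m`.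
  have hb : contr1 (bracket (euler 𝒜) X) η = (d.1 : ℝ) • contr1 X η := by
    rw [← contr1_smul]
    exact contr1_congr η (zero_add d) _ _ fun f => bracket_euler_val X f
  simp only [d1val, lie1, lie0_val, hb, euler_val hη, Prod.snd_zero, zero_mul, sgn_zero,
    one_smul, Prod.fst_add, Int.cast_add] at hc
  rw [← sub_eq_zero, ← hc]
  module

theorem hasDegree_d1 {η : Form1 𝒜} {m : Deg}
    (hη : ∀ (d : Deg) (X : VF 𝒜 d), contr1 X η ∈ 𝒜 (d + m)) : HasDegree (d1 η) m := by
  intro d e X Y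
  have h1 := vf_mem Y (hη d X)
  have h2 := hη _ (bracket Y X)
  have h3 := vf_mem X (hη e Y)
  rw [← add_assoc, add_comm e d] at h1
  -- Rewriting only the degree of the submodule leaves the index `e + d` of the bracket intact.
  rw [congrArg (fun c => 𝒜 (c + m)) (add_comm e d)] at h2
  rw [← add_assoc] at h3
  exact sub_mem (Submodule.smul_mem _ _ (sub_mem h1 h2)) (Submodule.smul_mem _ _ h3)

/-! ### The boundary 2-form and the boundary action -/

namespace WeakBV

variable {k : ℤ} (M : WeakBV 𝒜 k)

theorem gh_one_snd : (gh 1).2 = 1 := by simp [gh]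

theorem gh_add (m n : ℤ) : gh m + gh n = gh (m + n) := by simp [gh]

theorem bdryω_val {d e : Deg} (X : VF 𝒜 d) (Y : VF 𝒜 e) :
    contr1 X (contr2 Y M.bdryω) = d1val (contr2 M.Q M.ω) X Y := by
  rw [bdryω, contr2_d1, bdryα, d1val_sub, d1val_d0, sub_zero]

/-- Cartan's formula for the odd field `Q`, with `δω = 0`. -/
theorem bdryω_val_eq_lie {d e : Deg} (X : VF 𝒜 d) (Y : VF 𝒜 e) :
    contr1 X (contr2 Y M.bdryω) = -lie2 M.Q M.ω X Y := by
  have := M.ω_closed _ _ _ X Y M.Q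
  rw [d2val, gh_one_snd, sgn_one] at this
  rw [bdryω_val]
  linear_combination (norm := module) this

theorem bdryω_eq : M.bdryω = d1 (contr2 M.Q M.ω) :=
  Subtype.ext (funext fun _ => funext fun _ => LinearMap.ext fun X => LinearMap.ext fun Y =>
    M.bdryω_val X Y)

/-- `ι_Q ω̲` has ghost number `k + 1`. -/
theorem contr1_contr2_bdryω_mem {d : Deg} (X : VF 𝒜 d) :
    contr1 X (contr2 M.Q M.bdryω) ∈ 𝒜 (d + gh (k + 1)) := by
  have h : HasDegree M.bdryω (gh k) := by
    rw [bdryω_eq]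
    refine hasDegree_d1 fun d X => ?_
    have := M.ω_degree d (gh 1) X M.Q
    rwa [add_assoc, gh_add, show 1 + (k - 1) = k by ring] at this
  have := h d (gh 1) X M.Q
  rwa [add_assoc, gh_add, add_comm 1 k] at this

/-- `ι_Q ω̲` is closed. -/
theorem d1val_contr2_bdryω {d e : Deg} (X : VF 𝒜 d) (Y : VF 𝒜 e) :
    d1val (contr2 M.Q M.bdryω) X Y = 0 := by
  -- By Cartan's formula `δω̲ = 0` reads `L_Q ω̲ + δ ι_Q ω̲ = 0`, and the first term is `-½
  -- L_{[Q,Q]} ω = 0`.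
  have h1 := isClosedForm_d1 (contr2 M.Q M.ω) _ _ _ X Y M.Q
  rw [d2val, lie2_d1_contr2 M.ω_closed gh_one_snd, M.lie_QQ, smul_zero, gh_one_snd, sgn_one,
    ← bdryω_eq] at h1
  simpa using h1

/-- Contracting with `E` recovers a function from its differential: `ι_E δS̲ = E S̲ = (k + 1) S̲`.
-/
theorem bdryAction_unique (hk : k ≠ -1) {S' S'' : A} (h' : M.IsBdryAction S')
    (h'' : M.IsBdryAction S'') : S' = S'' := by
  have hk' : ((k + 1 : ℤ) : ℝ) ≠ 0 := by
    exact_mod_cast fun h => hk (by omega)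
  have h := congrArg (contr1 (euler 𝒜)) (h'.2.symm.trans h''.2)
  rw [contr1_d0, contr1_d0, euler_val h'.1, euler_val h''.1] at h
  exact smul_right_injective A hk' h

theorem exists_bdryAction (hk : k ≠ -1) : ∃ S' : A, M.IsBdryAction S' := by
  have hk' : ((k + 1 : ℤ) : ℝ) ≠ 0 := by
    exact_mod_cast fun h => hk (by omega)
  refine ⟨((k + 1 : ℤ) : ℝ)⁻¹ • contr1 (euler 𝒜) (contr2 M.Q M.bdryω), ?_, ?_⟩
  · have := M.contr1_contr2_bdryω_mem (euler 𝒜)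
    rw [zero_add] at this
    exact Submodule.smul_mem _ _ this
  · refine form1_ext fun d X => ?_
    rw [contr1_d0, map_smul, ← smul_contr1_of_closed X (M.contr1_contr2_bdryω_mem X)
      (M.d1val_contr2_bdryω X _)]
    exact (inv_smul_smul₀ hk' _).symm

/-! ### The boundary master equation -/

variable {M}

theorem IsViolation.contr1_QQ {T : A} (hT : M.IsViolation T) {d : Deg} (X : VF 𝒜 d) :
    contr1 X (contr2 M.QQ M.ω) = -(2 : ℝ) • X.1 T := by
  have h := congrArg (contr1 X) hT.2
  rw [contr1_form_smul, contr1_form_neg, contr1_d0] at h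
  linear_combination (norm := module) (2 : ℝ) • h

/-- `ι_Q ι_Q ω̲ = ι_Q ι_{[Q, Q]} ω`. -/
theorem contr1_contr2_bdryω_Q :
    contr1 M.Q (contr2 M.Q M.bdryω) = contr1 M.Q (contr2 M.QQ M.ω) := by
  have h1 := M.ω_closed _ _ _ M.Q M.Q M.Q
  have h2 := contr2_symm M.QQ M.Q M.ω
  rw [bdryω_val]
  simp only [d2val, lie2, d1val, lie1, lie0_val, QQ, Prod.snd_add, gh_one_snd, sgn_zero, sgn_one,
    CharTwo.add_self_eq_zero, mul_zero, one_smul] at h1 h2 ⊢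
  rw [h2] at h1 ⊢
  -- With `a = ι_Q ι_Q ω` and `b = ι_Q ι_{[Q,Q]} ω`, `h1` says `3 Q a - 3 b = 0`, while the goal is
  -- `2 Q a - b = b`.
  linear_combination (norm := module) (2 / 3 : ℝ) • h1

theorem half_lie0_bdryAction {T S' : A} (hT : M.IsViolation T) (hS : M.IsBdryAction S') :
    (1 / 2 : ℝ) • lie0 M.Q S' = -lie0 M.Q T := by
  rw [lie0, ← hS.2, contr1_contr2_bdryω_Q, hT.contr1_QQ, lie0_val]
  module

/-- Since `[Q,Q]` is even and commutes with `Q`, `ι_{[Q,Q]} ω̲ = -ι_{[Q,Q]} L_Q ω = L_Q ι_{[Q,Q]} ω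
= -2 L_Q δT = 2 δ L_Q T`. -/
theorem half_contr2_QQ_bdryω {T : A} (hT : M.IsViolation T) :
    (1 / 2 : ℝ) • contr2 M.QQ M.bdryω = -d0 (M.bdryT T) := by
  refine form1_ext fun d X => ?_
  -- With `[Q,Q] = 2 Q²` as an operator, this is the commutator of `Q` with its own square.
  have hQQQ : bracket M.Q M.QQ = 0 := by
    ext f
    simp only [QQ, bracket_val, Prod.snd_add, gh_one_snd, sgn_zero, sgn_one,
      CharTwo.add_self_eq_zero, mul_zero, mul_one, map_sub, map_smul, Submodule.coe_zero,
      LinearMap.zero_apply]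
    module
  rw [contr1_form_smul, contr1_form_neg, contr1_d0, bdryω_val_eq_lie, lie2, lie1, hQQQ,
    contr2_zero, hT.contr1_QQ, hT.contr1_QQ, bdryT, lie0_val, lie0_val, bracket_val]
  have h0 : contr1 X (0 : Form1 𝒜) = 0 := rfl
  rw [h0]
  simp only [Prod.snd_add, gh_one_snd, map_smul, map_neg, CharTwo.add_self_eq_zero, one_mul]
  rcases zmod2_cases d.2 with hd | hd <;>
    simp only [hd, sgn_zero, sgn_one, CharTwo.add_self_eq_zero, zero_add] <;> module

end WeakBV

end

end GrMfd

theorem mainTheorem3 {A : Type*} [Ring A] [Algebra ℝ A] (𝒜 : GrMfd.Deg → Submodule ℝ A)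
    [GradedAlgebra 𝒜] [GrMfd.SuperCommutative 𝒜] (k : ℤ) (M : GrMfd.WeakBV 𝒜 k) (T : A)
    (hT : M.IsViolation T) :
    (k ≠ -1 → ∃! S' : A, M.IsBdryAction S') ∧
    ∀ S' : A, M.IsBdryAction S' →
      (1 / 2 : ℝ) • GrMfd.lie0 M.Q S' = -GrMfd.lie0 M.Q T ∧
      (1 / 2 : ℝ) • GrMfd.lie0 M.Q S' = M.bdryT T ∧
      (1 / 2 : ℝ) • GrMfd.contr2 M.QQ M.bdryω = -GrMfd.d0 (M.bdryT T) := by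
  refine ⟨fun hk => ?_, fun S' hS => ?_⟩
  · obtain ⟨S', hS⟩ := M.exists_bdryAction hk
    exact ⟨S', hS, fun S'' hS' => M.bdryAction_unique hk hS' hS⟩
  · have h := GrMfd.WeakBV.half_lie0_bdryAction hT hS
    exact ⟨h, h, GrMfd.WeakBV.half_contr2_QQ_bdryω hT⟩
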